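/- A simple polygon is the closed region in the plane bounded by a closed polygonal curve without self-intersections. Let $\mathcal{I}$ be a finite set of pairwise disjoint simple polygons in $\mathbb{R}^2$, no three of whose vertices lie on a common line. For $\mathcal{Q}\subseteq\mathcal{I}$ write $\mathrm{CH}(\mathcal{Q})$ for the convex hull of the union of the polygons of $\mathcal{Q}$. The set $\mathcal{Q}$ is *bridgeable* by a finite set $S$ of closed segments with pairwise disjoint relative interiors if (i) $\bigcup\mathcal{Q}\cup\bigcup S$ is connected (and non-empty); (ii) the relative interior of every segment of $S$ is disjoint from the interior of every polygon of $\mathcal{I}$; (iii) every polygon of $\mathcal{I}$ that meets a segment of $S$ belongs to $\mathcal{Q}$; (iv) every segment of $S$ has at least one endpoint on the boundary of a polygon of $\mathcal{Q}$; (v) every segment of $S$ is contained in $\mathrm{CH}(\mathcal{Q})$. The set $\mathcal{Q}$ is *bridgeable* if it is bridgeable by some such $S$. Two sets $\mathcal{P}_1,\mathcal{P}_2\subseteq\mathcal{I}$ are *compatible* if $\mathcal{P}_1\cap\mathcal{P}_2=\emptyset$, there are sets $S_1,S_2$ of segments such that $\mathcal{P}_1$ is bridgeable by $S_1$, $\mathcal{P}_2$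 is bridgeable by $S_2$ and every segment of $S_1$ is disjoint from every segment of $S_2$, and $\mathcal{P}_1\cup\mathcal{P}_2$ is bridgeable. **Lemma.** If $\mathcal{P}_1,\mathcal{P}_2\subseteq\mathcal{I}$ are compatible, then $\partial\,\mathrm{CH}(\mathcal{P}_1)\cap\partial\,\mathrm{CH}(\mathcal{P}_2)$ consists of at most two points; that is, the two hulls behave like pseudo-disks (regions whose boundaries intersect at most twice). -/

import Mathlib

/-- The Euclidean plane. -/
abbrev Plane : Type := EuclideanSpace ℝ (Fin 2)

/-- A simple polygon in the plane: a cyclic sequence of at least three vertices whose closed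
polygonal boundary curve does not meet itself. -/
structure SimplePolygon where
  /-- The number of vertices. -/
  n : ℕ
  /-- The cyclic sequence of vertices. -/
  toPolygon : Polygon Plane n
  three_le : 3 ≤ n
  /-- The boundary curve, which runs through the `i`-th edge for `t ∈ [0, 1)`, is injective. -/
  simple : Set.InjOn (fun q : Fin n × ℝ => toPolygon.edgePath ℝ q.1 q.2)
    (Set.univ ×ˢ Set.Ico (0 : ℝ) 1)

namespace SimplePolygon

/-- The boundary curve of a simple polygon, as a set. -/
def boundary (P : SimplePolygon) : Set Plane :=
  P.toPolygon.boundary ℝ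

/-- The set of vertices of a simple polygon. -/
def vertexSet (P : SimplePolygon) : Set Plane :=
  Set.range P.toPolygon.vertices

/-- The closed region of the plane that a simple polygon stands for: its boundary curve together
with all points that lie in a bounded connected component of the complement of that curve. -/
def region (P : SimplePolygon) : Set Plane :=
  P.boundary ∪
    {x | x ∉ P.boundary ∧ Bornology.IsBounded (connectedComponentIn P.boundaryᶜ x)}

end SimplePolygon

/-- A closed nondegenerate line segment in the plane, given by its endpoints. -/
structure PlaneSegment where
  a : Plane
  b : Plane
  ne : a ≠ b

namespace PlaneSegment

/-- The closed segment as a set. -/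
def carrier (s : PlaneSegment) : Set Plane := segment ℝ s.a s.b

/-- The relative interior of the segment. -/
def relInterior (s : PlaneSegment) : Set Plane := openSegment ℝ s.a s.b

end PlaneSegment

/-- The union of a set of polygons. -/
def polyUnion (Q : Set SimplePolygon) : Set Plane := ⋃ P ∈ Q, P.region

/-- The union of a set of segments. -/
def segUnion (S : Set PlaneSegment) : Set Plane := ⋃ s ∈ S, s.carrier

/-- The combined convex hull of a set of polygons. -/
def hull (Q : Set SimplePolygon) : Set Plane := convexHull ℝ (polyUnion Q)

/-- A finite set of pairwise disjoint simple polygons, no three of whose vertices are collinear. -/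
structure IsPolygonInput (I : Set SimplePolygon) : Prop where
  finite : I.Finite
  disjoint : I.Pairwise fun P P' => Disjoint P.region P'.region
  generalPosition : ∀ x ∈ ⋃ P ∈ I, P.vertexSet, ∀ y ∈ ⋃ P ∈ I, P.vertexSet,
    ∀ z ∈ ⋃ P ∈ I, P.vertexSet, x ≠ y → y ≠ z → x ≠ z → ¬ Collinear ℝ {x, y, z}

/-- The set `Q ⊆ I` of polygons is bridgeable by the finite set `S` of segments. -/
structure BridgeableBy (I Q : Set SimplePolygon) (S : Set PlaneSegment) : Prop where
  subset : Q ⊆ I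
  finite : S.Finite
  /-- The segments are pairwise interior disjoint. -/
  interiorDisjoint : S.Pairwise fun s s' => Disjoint s.relInterior s'.relInterior
  connected : IsConnected (polyUnion Q ∪ segUnion S)
  /-- The segments and the polygons of `I` are interior disjoint. -/
  interiorDisjoint_polygon : ∀ s ∈ S, ∀ P ∈ I, Disjoint s.relInterior (interior P.region)
  /-- The segments meet no polygon of `I` outside `Q`. -/
  mem_of_meets : ∀ s ∈ S, ∀ P ∈ I, (s.carrier ∩ P.region).Nonempty → P ∈ Q
  /-- Each segment has at least one endpoint on the boundary of a polygon of `Q`. -/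
  endpoint : ∀ s ∈ S, ∃ P ∈ Q, s.a ∈ P.boundary ∨ s.b ∈ P.boundary
  /-- The segments lie within the convex hull of `Q`. -/
  subset_hull : ∀ s ∈ S, s.carrier ⊆ hull Q

/-- The set `Q ⊆ I` of polygons is bridgeable. -/
def Bridgeable (I Q : Set SimplePolygon) : Prop := ∃ S, BridgeableBy I Q S

/-- Two sets of polygons of `I` are compatible. -/
def Compatible (I P₁ P₂ : Set SimplePolygon) : Prop :=
  Disjoint P₁ P₂ ∧
  (∃ S₁ S₂ : Set PlaneSegment, BridgeableBy I P₁ S₁ ∧ BridgeableBy I P₂ S₂ ∧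
    ∀ s₁ ∈ S₁, ∀ s₂ ∈ S₂, Disjoint s₁.carrier s₂.carrier) ∧
  Bridgeable I (P₁ ∪ P₂)

/-! Let `X` and `Y` be the two bridged unions (polygons together with segments). They are disjoint
and path-connected, lie in the hulls `C₁` and `C₂`, and contain the hull vertices. By general
position, a common boundary point of the hulls is interior to an edge of each, and these edges cross
transversally. With both boundaries oriented so that the hull is on the left, such a crossing is of
one of two kinds, according to which boundary one leaves to turn right into the other. So it
suffices that each kind occurs at most once (`IsCrossing.eq_of_disjoint`).

Suppose one kind occurs twice, with edge starts `v₁, v₂` in `X` and edge ends `t₁, t₂` in `Y`. Then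
`v₁ t₁ v₂ t₂` is a positively oriented convex quadrilateral (`IsCrossing.orient_pos`). The paths
joining opposite corners may leave it, but the edge lines separate each corner from the other set.
If paths `γ` in `X` and `δ` in `Y` were disjoint, `γ(s) - δ(t)` would have a continuous argument on
the unit square; yet this argument strictly increases from corner to corner all the way round the
boundary, which is absurd. -/

/-! ### Continuous arguments and crossing paths -/

open Set Complex in
/-- Along a continuous logarithm of a curve that stays in an open half plane, the argument
increases when the endpoint lies to the left of the starting point. -/
theorem im_lt_im_of_exp_mem_halfPlane {h : ℝ → ℂ} (hc : Continuous h) (c : ℂ)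
    (hpos : ∀ t ∈ Icc (0 : ℝ) 1, 0 < c.re * (exp (h t)).im - c.im * (exp (h t)).re)
    (hend : 0 < (exp (h 0)).re * (exp (h 1)).im - (exp (h 0)).im * (exp (h 1)).re) :
    (h 0).im < (h 1).im := by
  have key : ∀ t ∈ Icc (0 : ℝ) 1,
      0 < c.re * Real.sin (h t).im - c.im * Real.cos (h t).im := by
    intro t ht
    have := hpos t ht
    rw [exp_re, exp_im] at this
    have h2 : 0 < Real.exp (h t).re *
        (c.re * Real.sin (h t).im - c.im * Real.cos (h t).im) := by linarith
    exact pos_of_mul_pos_right h2 (Real.exp_pos _).le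
  have hsin : 0 < Real.sin ((h 1).im - (h 0).im) := by
    rw [exp_re, exp_im, exp_re, exp_im] at hend
    have h2 : 0 < (Real.exp (h 0).re * Real.exp (h 1).re) *
        Real.sin ((h 1).im - (h 0).im) := by
      rw [Real.sin_sub]; linarith
    exact pos_of_mul_pos_right h2 (by positivity)
  have h0 := key 0 (by simp)
  have hcont : ContinuousOn (fun t => (h t).im) (Icc (0 : ℝ) 1) :=
    (continuous_im.comp hc).continuousOn
  by_contra! hle
  -- A non-increasing argument with positive sine of the difference must drop by at least π, hence
  -- pass through the direction opposite to the start, which is outside the half plane.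
  have hfar : (h 1).im ≤ (h 0).im - Real.pi := by
    by_contra! hlt
    exact absurd hsin (not_lt.2 (Real.sin_nonpos_of_nonpos_of_neg_pi_le (by linarith)
      (by linarith)))
  obtain ⟨t, ht, hte⟩ := intermediate_value_Icc' zero_le_one hcont
    (show (h 0).im - Real.pi ∈ Icc (h 1).im (h 0).im from ⟨hfar, by linarith [Real.pi_pos]⟩)
  have := key t ht
  simp only at hte
  rw [hte, Real.sin_sub_pi, Real.cos_sub_pi] at this
  linarith

open Complex in
/-- A continuous nowhere vanishing function on the plane has a continuous logarithm. -/
theorem exists_continuous_log {F : ℝ × ℝ → ℂ} (hF : Continuous F) (h0 : ∀ x, F x ≠ 0) :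
    ∃ G : ℝ × ℝ → ℂ, Continuous G ∧ ∀ x, exp (G x) = F x := by
  obtain ⟨G, ⟨-, hG⟩, -⟩ := isCoveringMapOn_exp.existsUnique_continuousMap_lifts
    (f := ⟨F, hF⟩) (a₀ := 0) (e₀ := log (F 0)) (by simpa using exp_log (h0 0))
    (by simpa using h0)
  exact ⟨G, G.continuous, fun x => congr_fun hG x⟩

/-- Twice the signed area of the triangle `a b c`. -/
def orient (a b c : Plane) : ℝ :=
  (b 0 - a 0) * (c 1 - a 1) - (b 1 - a 1) * (c 0 - a 0)

/-- Let `a₁ b₁ a₂ b₂` be a positively oriented convex quadrilateral. A path-connected set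
containing `a₁, a₂` meets a path-connected set containing `b₁, b₂`, if each of these four points
is separated by a line from the other set. -/
theorem not_disjoint_of_convex_quadrilateral {X Y : Set Plane} (hX : IsPathConnected X)
    (hY : IsPathConnected Y) {a₁ a₂ b₁ b₂ c₁ c₂ d₁ d₂ : Plane}
    (ha₁ : a₁ ∈ X) (ha₂ : a₂ ∈ X) (hb₁ : b₁ ∈ Y) (hb₂ : b₂ ∈ Y)
    (hc₁ : ∀ y ∈ Y, 0 < c₁ 0 * (y 1 - a₁ 1) - c₁ 1 * (y 0 - a₁ 0))
    (hc₂ : ∀ y ∈ Y, 0 < c₂ 0 * (y 1 - a₂ 1) - c₂ 1 * (y 0 - a₂ 0))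
    (hd₁ : ∀ x ∈ X, 0 < d₁ 0 * (x 1 - b₁ 1) - d₁ 1 * (x 0 - b₁ 0))
    (hd₂ : ∀ x ∈ X, 0 < d₂ 0 * (x 1 - b₂ 1) - d₂ 1 * (x 0 - b₂ 0))
    (h₁ : 0 < orient a₁ b₁ b₂) (h₂ : 0 < orient b₁ a₂ a₁)
    (h₃ : 0 < orient a₂ b₂ b₁) (h₄ : 0 < orient b₂ a₁ a₂) : ¬ Disjoint X Y := by
  intro hdisj
  obtain ⟨γ, hγ⟩ := hX.joinedIn a₁ ha₁ a₂ ha₂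
  obtain ⟨δ, hδ⟩ := hY.joinedIn b₁ hb₁ b₂ hb₂
  have hγX : ∀ s, γ.extend s ∈ X := fun s => hγ _
  have hδY : ∀ s, δ.extend s ∈ Y := fun s => hδ _
  -- Constant extension of the paths beyond `[0, 1]` makes the difference a map on the whole, simply
  -- connected, parameter plane.
  let F : ℝ × ℝ → ℂ := fun q =>
    ⟨γ.extend q.1 0 - δ.extend q.2 0, γ.extend q.1 1 - δ.extend q.2 1⟩
  have hFc : Continuous F := by
    have h1 : ∀ i, Continuous fun q : ℝ × ℝ => γ.extend q.1 i - δ.extend q.2 i := fun i =>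
      (((EuclideanSpace.proj (𝕜 := ℝ) i).continuous.comp γ.continuous_extend).comp
        continuous_fst).sub
      (((EuclideanSpace.proj (𝕜 := ℝ) i).continuous.comp δ.continuous_extend).comp
        continuous_snd)
    exact Complex.equivRealProdCLM.symm.continuous.comp ((h1 0).prodMk (h1 1))
  have hF0 : ∀ q, F q ≠ 0 := by
    intro q hq
    refine hdisj.le_bot ⟨hγX q.1, ?_⟩
    have : γ.extend q.1 = δ.extend q.2 := by
      ext i
      have h0 := congrArg Complex.re hq
      have h1 := congrArg Complex.im hq
      simp only [F, Complex.zero_re, Complex.zero_im] at h0 h1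
      fin_cases i
      · simpa using sub_eq_zero.1 h0
      · simpa using sub_eq_zero.1 h1
    rw [this]; exact hδY _
  obtain ⟨G, hG, hGF⟩ := exists_continuous_log hFc hF0
  have e0 : γ.extend 0 = a₁ := by simp
  have e1 : γ.extend 1 = a₂ := by simp
  have f0 : δ.extend 0 = b₁ := by simp
  have f1 : δ.extend 1 = b₂ := by simp
  -- One full turn round the square, one side at a time. On the sides where `γ` is fixed the
  -- direction changes sign, since `F` is then the fixed point minus the moving one.
  have A : (G (0, 0)).im < (G (0, 1)).im := by
    have := im_lt_im_of_exp_mem_halfPlane (h := fun t => G (0, t)) (by fun_prop)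
      ⟨-c₁ 0, -c₁ 1⟩ (fun t _ => by
        simp only [hGF, F, e0]; have := hc₁ _ (hδY t); linarith)
      (by simp only [hGF, F, e0, f0, f1]; unfold orient at h₁; linarith)
    exact this
  have B : (G (0, 1)).im < (G (1, 1)).im := by
    have := im_lt_im_of_exp_mem_halfPlane (h := fun t => G (t, 1)) (by fun_prop)
      ⟨d₂ 0, d₂ 1⟩ (fun t _ => by
        simp only [hGF, F, f1]; have := hd₂ _ (hγX t); linarith)
      (by simp only [hGF, F, e0, e1, f1]; unfold orient at h₄; linarith)
    exact this
  have C : (G (1, 1)).im < (G (1, 0)).im := by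
    have := im_lt_im_of_exp_mem_halfPlane (h := fun t => G (1, 1 - t)) (by fun_prop)
      ⟨-c₂ 0, -c₂ 1⟩ (fun t _ => by
        simp only [hGF, F, e1]; have := hc₂ _ (hδY (1 - t)); linarith)
      (by simp only [hGF, F, e1, f0, f1, sub_zero, sub_self]; unfold orient at h₃; linarith)
    simpa using this
  have D : (G (1, 0)).im < (G (0, 0)).im := by
    have := im_lt_im_of_exp_mem_halfPlane (h := fun t => G (1 - t, 0)) (by fun_prop)
      ⟨d₁ 0, d₁ 1⟩ (fun t _ => by
        simp only [hGF, F, f0]; have := hd₁ _ (hγX (1 - t)); linarith)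
      (by simp only [hGF, F, e0, e1, f0, sub_zero, sub_self]; unfold orient at h₂; linarith)
    simpa using this
  linarith

/-! ### Crossings of two hull boundaries -/

/-- The boundaries of `C₁` and `C₂` cross at `p`: a boundary ray of `C₁` from `v` to `p`, with
`C₁` on its left, and a boundary ray of `C₂` from `p` to `t`, with `C₂` on its left, make a right
turn at `p`. -/
structure IsCrossing (C₁ C₂ : Set Plane) (p v t : Plane) : Prop where
  mem_left : p ∈ C₁
  mem_right : p ∈ C₂
  start_mem : v ∈ C₁
  end_mem : t ∈ C₂
  left : ∀ x ∈ C₁, 0 ≤ orient v p x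
  right : ∀ y ∈ C₂, 0 ≤ orient p t y
  turn : orient v p t < 0

/-- The reflection of the plane in the diagonal. -/
def planeSwap (x : Plane) : Plane := !₂[x 1, x 0]

theorem planeSwap_injective : Function.Injective planeSwap := by
  intro x y h
  have h0 : x 1 = y 1 := by simpa [planeSwap] using congrArg (fun z : Plane => z 0) h
  have h1 : x 0 = y 0 := by simpa [planeSwap] using congrArg (fun z : Plane => z 1) h
  ext i
  fin_cases i
  · exact h1
  · exact h0

theorem orient_planeSwap (a b c : Plane) :
    orient (planeSwap a) (planeSwap b) (planeSwap c) = orient b a c := by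
  simp only [orient, planeSwap, PiLp.toLp_apply, Matrix.cons_val_zero, Matrix.cons_val_one]
  ring

/-- A reflection reverses orientation, so it also reverses the two boundary rays and exchanges the
roles of the sets. This symmetry yields the quadrilateral inequalities at the `t` corners from those
at the `v` corners. -/
theorem IsCrossing.planeSwap {C₁ C₂ : Set Plane} {p v t : Plane} (h : IsCrossing C₁ C₂ p v t) :
    IsCrossing (planeSwap '' C₂) (planeSwap '' C₁) (planeSwap p) (planeSwap t) (planeSwap v) where
  mem_left := ⟨p, h.mem_right, rfl⟩
  mem_right := ⟨p, h.mem_left, rfl⟩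
  start_mem := ⟨t, h.end_mem, rfl⟩
  end_mem := ⟨v, h.start_mem, rfl⟩
  left := by
    rintro _ ⟨x, hx, rfl⟩
    rw [orient_planeSwap]; exact h.right x hx
  right := by
    rintro _ ⟨x, hx, rfl⟩
    rw [orient_planeSwap]; exact h.left x hx
  turn := by
    rw [orient_planeSwap]
    have := h.turn
    unfold orient at *
    linarith

/-- In the coordinates below, `C₁` lies in `X ≤ 0` and `C₂` in `Y ≥ 0`. If the inequality failed,
`p₁` could be on the left of `p₂ t₂` only by lying strictly between `p₂` and `t₂`; the right turn at
`p₂` would then put `p₁ ∈ C₁` strictly to the right of `v₂ p₂`. -/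
theorem IsCrossing.orient_pos {C₁ C₂ : Set Plane} {p₁ v₁ t₁ p₂ v₂ t₂ : Plane}
    (h₁ : IsCrossing C₁ C₂ p₁ v₁ t₁) (h₂ : IsCrossing C₁ C₂ p₂ v₂ t₂) (hne : p₁ ≠ p₂) :
    0 < orient v₁ t₁ t₂ := by
  set Δ := -orient v₁ p₁ t₁ with hΔdef
  have hΔ : 0 < Δ := by have := h₁.turn; linarith
  -- coordinates with origin `p₁` in the basis `t₁ - p₁`, `p₁ - v₁`
  have coord : ∀ x : Plane, ∃ X Y : ℝ,
      x 0 = p₁ 0 + X * (t₁ 0 - p₁ 0) + Y * (p₁ 0 - v₁ 0) ∧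
      x 1 = p₁ 1 + X * (t₁ 1 - p₁ 1) + Y * (p₁ 1 - v₁ 1) := by
    intro x
    refine ⟨-orient v₁ p₁ x / Δ, orient p₁ t₁ x / Δ, ?_, ?_⟩ <;>
    · field_simp
      rw [hΔdef]
      unfold orient
      ring
  obtain ⟨X, Y, hX0, hX1⟩ := coord p₂
  obtain ⟨c, d, hc0, hc1⟩ := coord t₂
  have hX : X ≤ 0 := by
    have h := h₁.left p₂ h₂.mem_left
    have : orient v₁ p₁ p₂ = Δ * (-X) := by
      rw [hΔdef]; unfold orient; rw [hX0, hX1]; ring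
    rw [this] at h
    linarith [nonneg_of_mul_nonneg_right h hΔ]
  have hY : 0 ≤ Y := by
    have h := h₁.right p₂ h₂.mem_right
    have : orient p₁ t₁ p₂ = Δ * Y := by
      rw [hΔdef]; unfold orient; rw [hX0, hX1]; ring
    rw [this] at h
    exact nonneg_of_mul_nonneg_right h hΔ
  have hd : 0 ≤ d := by
    have h := h₁.right t₂ h₂.end_mem
    have : orient p₁ t₁ t₂ = Δ * d := by
      rw [hΔdef]; unfold orient; rw [hc0, hc1]; ring
    rw [this] at h
    exact nonneg_of_mul_nonneg_right h hΔ
  by_contra! hneg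
  have hc : d + 1 ≤ c := by
    have : orient v₁ t₁ t₂ = Δ * (d + 1 - c) := by
      rw [hΔdef]; unfold orient; rw [hc0, hc1]; ring
    rw [this] at hneg
    by_contra! hlt
    exact absurd (mul_pos hΔ (by linarith : 0 < d + 1 - c)) (not_lt.2 hneg)
  have hturn : 0 ≤ -(c * Y) + d * X := by
    have h := h₂.right p₁ h₁.mem_right
    have : orient p₂ t₂ p₁ = Δ * (-(c * Y) + d * X) := by
      rw [hΔdef]; unfold orient; rw [hX0, hX1, hc0, hc1]; ring
    rw [this] at h
    exact nonneg_of_mul_nonneg_right h hΔ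
  have hcY : 0 ≤ c * Y := mul_nonneg (by linarith) hY
  have hdX : d * X ≤ 0 := mul_nonpos_of_nonneg_of_nonpos hd hX
  have hY0 : Y = 0 := by
    have : c * Y = 0 := by linarith
    exact (mul_eq_zero.1 this).resolve_left (by linarith)
  have hX0' : X ≠ 0 := by
    rintro rfl
    apply hne
    ext i
    fin_cases i
    · simp [hX0, hY0]
    · simp [hX1, hY0]
  have hd0 : d = 0 := by
    have : d * X = 0 := by linarith
    exact (mul_eq_zero.1 this).resolve_right hX0'
  have hXneg : X < 0 := lt_of_le_of_ne hX hX0'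
  have h := h₂.left p₁ h₁.mem_left
  -- Here `p₂ = (X, 0)`, `p₁ = (0, 0)` and `t₂ = (c, 0)` with `X < 0 < c`, so the two orientations
  -- are proportional.
  have hEq : (c - X) * orient v₂ p₂ p₁ = -X * orient v₂ p₂ t₂ := by
    subst hY0 hd0
    unfold orient
    rw [hX0, hX1, hc0, hc1]
    ring
  have h3 := mul_neg_of_pos_of_neg (by linarith : 0 < -X) h₂.turn
  have h4 := mul_nonneg (by linarith : 0 ≤ c - X) h
  linarith

/-- Disjoint path-connected sets with hulls `C₁` and `C₂` allow at most one crossing of each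
kind. -/
theorem IsCrossing.eq_of_disjoint {C₁ C₂ X Y : Set Plane} {p₁ v₁ t₁ p₂ v₂ t₂ : Plane}
    (hX : IsPathConnected X) (hY : IsPathConnected Y) (hXC : X ⊆ C₁) (hYC : Y ⊆ C₂)
    (hdisj : Disjoint X Y) (h₁ : IsCrossing C₁ C₂ p₁ v₁ t₁) (h₂ : IsCrossing C₁ C₂ p₂ v₂ t₂)
    (hv₁ : v₁ ∈ X) (hv₂ : v₂ ∈ X) (ht₁ : t₁ ∈ Y) (ht₂ : t₂ ∈ Y) : p₁ = p₂ := by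
  by_contra hne
  have hne' := planeSwap_injective.ne hne
  have k₁ := h₁.orient_pos h₂ hne
  have k₃ := h₂.orient_pos h₁ (Ne.symm hne)
  have k₂ := h₁.planeSwap.orient_pos h₂.planeSwap hne'
  have k₄ := h₂.planeSwap.orient_pos h₁.planeSwap hne'.symm
  rw [orient_planeSwap] at k₂ k₄
  refine not_disjoint_of_convex_quadrilateral hX hY hv₁ hv₂ ht₁ ht₂
    (c₁ := t₁ - p₁) (c₂ := t₂ - p₂) (d₁ := p₁ - v₁) (d₂ := p₂ - v₂) ?_ ?_ ?_ ?_ k₁ ?_ k₃ ?_ hdisj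
  · intro y hy
    have a := h₁.right y (hYC hy)
    have b := h₁.turn
    simp only [orient, PiLp.sub_apply] at *
    linarith
  · intro y hy
    have a := h₂.right y (hYC hy)
    have b := h₂.turn
    simp only [orient, PiLp.sub_apply] at *
    linarith
  · intro x hx
    have a := h₁.left x (hXC hx)
    have b := h₁.turn
    simp only [orient, PiLp.sub_apply] at *
    linarith
  · intro x hx
    have a := h₂.left x (hXC hx)
    have b := h₂.turn
    simp only [orient, PiLp.sub_apply] at *
    linarith
  · unfold orient at *; linarith
  · unfold orient at *; linarith

/-! ### Edges of hulls in general position -/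

theorem collinear_of_orient_eq_zero {a b c : Plane} (h : orient a b c = 0) :
    Collinear ℝ {a, b, c} := by
  by_cases hab : a = b
  · subst hab
    simpa using collinear_pair ℝ a c
  rw [collinear_iff_of_mem (p₀ := a) (by simp)]
  have hne : (b 0 - a 0) ^ 2 + (b 1 - a 1) ^ 2 ≠ 0 := by
    intro h0
    apply hab
    have h1 : b 0 - a 0 = 0 := by nlinarith [sq_nonneg (b 0 - a 0), sq_nonneg (b 1 - a 1)]
    have h2 : b 1 - a 1 = 0 := by nlinarith [sq_nonneg (b 0 - a 0), sq_nonneg (b 1 - a 1)]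
    ext i
    fin_cases i
    · simpa using (sub_eq_zero.1 h1).symm
    · simpa using (sub_eq_zero.1 h2).symm
  refine ⟨b - a, ?_⟩
  rintro x (rfl | rfl | rfl)
  · exact ⟨0, by simp⟩
  · exact ⟨1, by simp⟩
  -- The coefficient of the orthogonal projection onto the line `a b`.
  · refine ⟨((x 0 - a 0) * (b 0 - a 0) + (x 1 - a 1) * (b 1 - a 1)) /
      ((b 0 - a 0) ^ 2 + (b 1 - a 1) ^ 2), ?_⟩
    unfold orient at h
    ext i
    fin_cases i
    · simp only [Fin.zero_eta, vadd_eq_add, PiLp.add_apply, PiLp.smul_apply, PiLp.sub_apply,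
        smul_eq_mul]
      field_simp
      linear_combination (-(b 1 - a 1)) * h
    · simp only [Fin.mk_one, vadd_eq_add, PiLp.add_apply, PiLp.smul_apply, PiLp.sub_apply,
        smul_eq_mul]
      field_simp
      linear_combination (b 0 - a 0) * h

theorem Plane.apply_eq (f : StrongDual ℝ Plane) (x : Plane) :
    f x = f (EuclideanSpace.single 0 1) * x 0 + f (EuclideanSpace.single 1 1) * x 1 := by
  have hx : x = x 0 • EuclideanSpace.single 0 (1 : ℝ) + x 1 • EuclideanSpace.single 1 (1 : ℝ) := by
    ext i
    fin_cases i <;> simp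
  conv_lhs => rw [hx]
  simp only [map_add, map_smul, smul_eq_mul]
  ring

/-- For two points on a level line of a functional, the orientation is proportional to the
functional. -/
theorem orient_mul_eq (f : StrongDual ℝ Plane) {v w : Plane} (h : f v = f w) (x : Plane) :
    (f (EuclideanSpace.single 0 1) ^ 2 + f (EuclideanSpace.single 1 1) ^ 2) * orient v w x =
      (f (EuclideanSpace.single 1 1) * (w 0 - v 0) - f (EuclideanSpace.single 0 1) * (w 1 - v 1)) *
        (f x - f v) := by
  rw [Plane.apply_eq f v, Plane.apply_eq f w] at h
  rw [Plane.apply_eq f x, Plane.apply_eq f v]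
  unfold orient
  linear_combination (-(f (EuclideanSpace.single 0 1) * (x 1 - v 1) -
    f (EuclideanSpace.single 1 1) * (x 0 - v 0))) * h

/-- A convex combination attaining the maximum of `f` gives no weight to points where `f` is
smaller. -/
theorem mem_convexHull_inter_level {V : Set Plane} {p : Plane} (hp : p ∈ convexHull ℝ V)
    (f : StrongDual ℝ Plane) (hf : ∀ x ∈ V, f x ≤ f p) :
    p ∈ convexHull ℝ (V ∩ {x | f x = f p}) := by
  have hlt : convexHull ℝ (V ∩ {x | f x < f p}) ⊆ {x | f x < f p} :=
    convexHull_min Set.inter_subset_right (convex_halfSpace_lt f.toLinearMap.isLinear _)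
  have hle : convexHull ℝ (V ∩ {x | f x = f p}) ⊆ {x | f x = f p} :=
    convexHull_min Set.inter_subset_right (convex_hyperplane f.toLinearMap.isLinear _)
  have hV : V = (V ∩ {x | f x = f p}) ∪ (V ∩ {x | f x < f p}) := by
    ext x
    constructor
    · intro hx
      rcases (hf x hx).eq_or_lt with h | h
      · exact Or.inl ⟨hx, h⟩
      · exact Or.inr ⟨hx, h⟩
    · rintro (h | h) <;> exact h.1
  rcases (V ∩ {x | f x < f p}).eq_empty_or_nonempty with he | hne
  · rw [he, Set.union_empty] at hV
    rwa [← hV]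
  rcases (V ∩ {x | f x = f p}).eq_empty_or_nonempty with he | hne'
  · rw [he, Set.empty_union] at hV
    rw [hV] at hp
    exact absurd (hlt hp) (lt_irrefl (f p))
  rw [hV, convexHull_union hne' hne, mem_convexJoin] at hp
  obtain ⟨a, ha, b, hb, s, t, hs, ht, hst, hab⟩ := hp
  have hfa : f a = f p := hle ha
  have hfb : f b < f p := hlt hb
  have hfp : s * f a + t * f b = f p := by rw [← hab]; simp
  have ht0 : t = 0 := by
    by_contra h0
    have : 0 < t := lt_of_le_of_ne ht (Ne.symm h0)
    have := mul_lt_mul_of_pos_left hfb this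
    rw [hfa] at hfp
    have h1 : s * f p + t * f p = f p := by rw [← add_mul, hst, one_mul]
    linarith
  have hs1 : s = 1 := by linarith
  rw [ht0, hs1, one_smul, zero_smul, add_zero] at hab
  subst hab
  exact ha

/-- A boundary point of the hull of a planar set in general position is a point of the set or lies
inside an edge. -/
theorem exists_edge_of_mem_frontier_convexHull {V : Set Plane} (hfin : V.Finite)
    (gp : ∀ x ∈ V, ∀ y ∈ V, ∀ z ∈ V, x ≠ y → y ≠ z → x ≠ z → orient x y z ≠ 0)
    (hint : (interior (convexHull ℝ V)).Nonempty) {p : Plane}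
    (hp : p ∈ frontier (convexHull ℝ V)) :
    p ∈ V ∨ ∃ v ∈ V, ∃ w ∈ V, v ≠ w ∧ p ∈ openSegment ℝ v w ∧
      ∀ x ∈ convexHull ℝ V, 0 ≤ orient v w x := by
  have hconv := convex_convexHull ℝ V
  have hpC : p ∈ convexHull ℝ V := (hfin.isClosed_convexHull (𝕜 := ℝ)).frontier_subset hp
  obtain ⟨f, hf⟩ := geometric_hahn_banach_open_point hconv.interior isOpen_interior hp.2
  have hle : ∀ x ∈ convexHull ℝ V, f x ≤ f p := by
    intro x hx
    have hx' : x ∈ closure (interior (convexHull ℝ V)) := by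
      rw [hconv.closure_interior_eq_closure_of_nonempty_interior hint]
      exact subset_closure hx
    exact closure_minimal (t := {x | f x ≤ f p}) (fun a ha => (hf a ha).le)
      (isClosed_le f.continuous continuous_const) hx'
  have hf0 : 0 < f (EuclideanSpace.single 0 1) ^ 2 + f (EuclideanSpace.single 1 1) ^ 2 := by
    rcases (add_nonneg (sq_nonneg (f (EuclideanSpace.single 0 1)))
      (sq_nonneg (f (EuclideanSpace.single 1 1)))).lt_or_eq with h | h
    · exact h
    · obtain ⟨a, ha⟩ := hint
      have h0 : f (EuclideanSpace.single 0 1) = 0 := by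
        nlinarith [sq_nonneg (f (EuclideanSpace.single 0 1)),
          sq_nonneg (f (EuclideanSpace.single 1 1))]
      have h1 : f (EuclideanSpace.single 1 1) = 0 := by
        nlinarith [sq_nonneg (f (EuclideanSpace.single 0 1)),
          sq_nonneg (f (EuclideanSpace.single 1 1))]
      have := hf a ha
      rw [Plane.apply_eq f a, Plane.apply_eq f p, h0, h1] at this
      simp at this
  have hmem := mem_convexHull_inter_level hpC f (fun x hx => hle x (subset_convexHull ℝ V hx))
  obtain ⟨v, hvV, hv⟩ : (V ∩ {x | f x = f p}).Nonempty :=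
    convexHull_nonempty_iff.1 ⟨p, hmem⟩
  change f v = f p at hv
  by_cases hsing : ∀ w ∈ V ∩ {x | f x = f p}, w = v
  · left
    have : p ∈ convexHull ℝ {v} := convexHull_mono hsing hmem
    rw [convexHull_singleton] at this
    rwa [Set.mem_singleton_iff.1 this]
  push Not at hsing
  obtain ⟨w, ⟨hwV, hw⟩, hwv⟩ := hsing
  change f w = f p at hw
  -- By general position the supporting line contains no third point of `V`.
  have hpair : V ∩ {x | f x = f p} ⊆ {v, w} := by
    rintro u ⟨huV, hu⟩
    change f u = f p at hu
    by_contra hne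
    simp only [Set.mem_insert_iff, Set.mem_singleton_iff, not_or] at hne
    apply gp v hvV w hwV u huV hwv.symm (Ne.symm hne.2) (Ne.symm hne.1)
    have := orient_mul_eq f (hv.trans hw.symm) u
    rw [hu, hv, sub_self, mul_zero] at this
    exact (mul_eq_zero.1 this).resolve_left hf0.ne'
  have hseg : p ∈ segment ℝ v w := by
    rw [← convexHull_pair]
    exact convexHull_mono hpair hmem
  by_cases hpv : p = v
  · exact Or.inl (hpv ▸ hvV)
  by_cases hpw : p = w
  · exact Or.inl (hpw ▸ hwV)
  right
  have hopen : p ∈ openSegment ℝ v w :=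
    mem_openSegment_of_ne_left_right (Ne.symm hpv) (Ne.symm hpw) hseg
  have nonneg : ∀ {a b : Plane}, f a = f p → f b = f p →
      f (EuclideanSpace.single 1 1) * (b 0 - a 0) -
        f (EuclideanSpace.single 0 1) * (b 1 - a 1) ≤ 0 →
      ∀ x ∈ convexHull ℝ V, 0 ≤ orient a b x := by
    intro a b ha hb hs x hx
    have h1 := orient_mul_eq f (ha.trans hb.symm) x
    have h2 := mul_nonneg_of_nonpos_of_nonpos hs
      (by rw [ha]; linarith [hle x hx] : f x - f a ≤ 0)
    rw [← h1] at h2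
    exact nonneg_of_mul_nonneg_right h2 hf0
  rcases le_total (f (EuclideanSpace.single 1 1) * (w 0 - v 0) -
        f (EuclideanSpace.single 0 1) * (w 1 - v 1)) 0 with hs | hs
  · exact ⟨v, hvV, w, hwV, hwv.symm, hopen, nonneg hv hw hs⟩
  · exact ⟨w, hwV, v, hvV, hwv, openSegment_symm ℝ v w ▸ hopen, nonneg hw hv (by linarith)⟩

theorem apply_of_mem_openSegment {v w p : Plane} (h : p ∈ openSegment ℝ v w) :
    ∃ l : ℝ, 0 < l ∧ l < 1 ∧ ∀ i, p i = v i + l * (w i - v i) := by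
  obtain ⟨a, b, ha, hb, hab, rfl⟩ := h
  refine ⟨b, hb, by linarith, fun i => ?_⟩
  obtain rfl : a = 1 - b := by linarith
  simp only [PiLp.add_apply, PiLp.smul_apply, smul_eq_mul]
  ring

theorem orient_eq_zero_of_mem_openSegment {v w p : Plane} (h : p ∈ openSegment ℝ v w) :
    orient v w p = 0 := by
  obtain ⟨l, -, -, hl⟩ := apply_of_mem_openSegment h
  unfold orient
  rw [hl 0, hl 1]
  ring

/-- Every common boundary point of the hulls of two disjoint finite sets that are jointly in
general position is a crossing. -/
theorem exists_isCrossing_of_mem_frontier {V W : Set Plane} (hV : V.Finite) (hW : W.Finite)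
    (hdisj : Disjoint V W)
    (gp : ∀ x ∈ V ∪ W, ∀ y ∈ V ∪ W, ∀ z ∈ V ∪ W,
      x ≠ y → y ≠ z → x ≠ z → orient x y z ≠ 0)
    (hVi : (interior (convexHull ℝ V)).Nonempty) (hWi : (interior (convexHull ℝ W)).Nonempty)
    {p : Plane} (hpV : p ∈ frontier (convexHull ℝ V)) (hpW : p ∈ frontier (convexHull ℝ W)) :
    (∃ v ∈ V, ∃ t ∈ W, IsCrossing (convexHull ℝ V) (convexHull ℝ W) p v t) ∨
      ∃ v ∈ W, ∃ t ∈ V, IsCrossing (convexHull ℝ W) (convexHull ℝ V) p v t := by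
  have hne : ∀ {x y}, x ∈ V → y ∈ W → x ≠ y := fun hx hy => hdisj.ne_of_mem hx hy
  have gpV : ∀ x ∈ V, ∀ y ∈ V, ∀ z ∈ V, x ≠ y → y ≠ z → x ≠ z → orient x y z ≠ 0 :=
    fun x hx y hy z hz => gp x (.inl hx) y (.inl hy) z (.inl hz)
  have gpW : ∀ x ∈ W, ∀ y ∈ W, ∀ z ∈ W, x ≠ y → y ≠ z → x ≠ z → orient x y z ≠ 0 :=
    fun x hx y hy z hz => gp x (.inr hx) y (.inr hy) z (.inr hz)
  have hpVC : p ∈ convexHull ℝ V := (hV.isClosed_convexHull (𝕜 := ℝ)).frontier_subset hpV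
  have hpWC : p ∈ convexHull ℝ W := (hW.isClosed_convexHull (𝕜 := ℝ)).frontier_subset hpW
  rcases exists_edge_of_mem_frontier_convexHull hV gpV hVi hpV with
    hpV' | ⟨v, hv, w, hw, hvw, hpvw, hleft⟩
  · rcases exists_edge_of_mem_frontier_convexHull hW gpW hWi hpW with
      hpW' | ⟨z, hz, t, ht, hzt, hpzt, -⟩
    · exact absurd rfl (hne hpV' hpW')
    · exact absurd (orient_eq_zero_of_mem_openSegment hpzt)
        (gp z (.inr hz) t (.inr ht) p (.inl hpV') hzt (hne hpV' ht).symm (hne hpV' hz).symm)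
  rcases exists_edge_of_mem_frontier_convexHull hW gpW hWi hpW with
    hpW' | ⟨z, hz, t, ht, hzt, hpzt, hright⟩
  · exact absurd (orient_eq_zero_of_mem_openSegment hpvw)
      (gp v (.inl hv) w (.inl hw) p (.inr hpW') hvw (hne hw hpW') (hne hv hpW'))
  have hvwt := gp v (.inl hv) w (.inl hw) t (.inr ht) hvw (hne hw ht) (hne hv ht)
  obtain ⟨l, hl0, hl1, hl⟩ := apply_of_mem_openSegment hpvw
  obtain ⟨m, hm0, hm1, hm⟩ := apply_of_mem_openSegment hpzt
  have e₁ : ∀ x, orient v p x = l * orient v w x := by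
    intro x; unfold orient; rw [hl 0, hl 1]; ring
  have e₂ : ∀ x, orient p w x = (1 - l) * orient v w x := by
    intro x; unfold orient; rw [hl 0, hl 1]; ring
  have e₃ : ∀ x, orient z p x = m * orient z t x := by
    intro x; unfold orient; rw [hm 0, hm 1]; ring
  have e₄ : ∀ x, orient p t x = (1 - m) * orient z t x := by
    intro x; unfold orient; rw [hm 0, hm 1]; ring
  -- The side of `v w` on which `t` lies decides the kind of crossing. If `t` is on the left, `z` is
  -- on the right because `p` lies between them, and the right turn goes from `z p` into `p w`.
  rcases hvwt.lt_or_gt with hlt | hgt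
  · exact Or.inl ⟨v, hv, t, ht, hpVC, hpWC, subset_convexHull ℝ V hv, subset_convexHull ℝ W ht,
      fun x hx => e₁ x ▸ mul_nonneg hl0.le (hleft x hx),
      fun y hy => e₄ y ▸ mul_nonneg (by linarith) (hright y hy),
      e₁ t ▸ mul_neg_of_pos_of_neg hl0 hlt⟩
  · refine Or.inr ⟨z, hz, w, hw, hpWC, hpVC, subset_convexHull ℝ W hz, subset_convexHull ℝ V hw,
      fun x hx => e₃ x ▸ mul_nonneg hm0.le (hright x hx),
      fun y hy => e₂ y ▸ mul_nonneg (by linarith) (hleft y hy), ?_⟩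
    have hp0 : (1 - m) * orient v w z + m * orient v w t = 0 := by
      have h0 := orient_eq_zero_of_mem_openSegment hpvw
      have : orient v w p = (1 - m) * orient v w z + m * orient v w t := by
        unfold orient; rw [hm 0, hm 1]; ring
      rw [← this, h0]
    have hz : orient v w z < 0 := by
      have h1 := mul_pos hm0 hgt
      have h2 : (1 - m) * orient v w z < 0 := by linarith
      exact neg_of_mul_neg_right h2 (by linarith)
    have hcyc : orient z p w = orient p w z := by unfold orient; ring
    rw [hcyc, e₂]
    exact mul_neg_of_pos_of_neg (by linarith) hz

/-! ### Topology of polygon regions and of finite unions -/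

/-- A connected finite union of closed path-connected sets is path-connected. -/
theorem isPathConnected_sUnion_of_isConnected {α : Type*} [TopologicalSpace α]
    {𝒮 : Set (Set α)} (hfin : 𝒮.Finite) (hcl : ∀ s ∈ 𝒮, IsClosed s)
    (hpc : ∀ s ∈ 𝒮, IsPathConnected s) (hconn : IsConnected (⋃₀ 𝒮)) :
    IsPathConnected (⋃₀ 𝒮) := by
  obtain ⟨x, hx⟩ := hconn.nonempty
  refine ⟨x, hx, ?_⟩
  -- The pieces reachable from `x` and the unreachable ones have closed unions covering everything;
  -- connectedness forces a common point, which makes an unreachable piece reachable.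
  let A : Set (Set α) := {s ∈ 𝒮 | ∃ y ∈ s, JoinedIn (⋃₀ 𝒮) x y}
  let B : Set (Set α) := {s ∈ 𝒮 | ¬ ∃ y ∈ s, JoinedIn (⋃₀ 𝒮) x y}
  have hA : ∀ s ∈ A, ∀ z ∈ s, JoinedIn (⋃₀ 𝒮) x z := by
    rintro s ⟨hs, y, hy, hxy⟩ z hz
    exact hxy.trans (((hpc s hs).joinedIn y hy z hz).mono (Set.subset_sUnion_of_mem hs))
  have hclosed : ∀ C ⊆ 𝒮, IsClosed (⋃₀ C) := by
    intro C hC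
    rw [Set.sUnion_eq_biUnion]
    exact (hfin.subset hC).isClosed_biUnion fun s hs => hcl s (hC hs)
  intro z hz
  by_contra hnot
  obtain ⟨s, hs, hzs⟩ := hz
  obtain ⟨r, hr, hxr⟩ := hx
  have hsB : s ∈ B := ⟨hs, fun h => hnot (hA s ⟨hs, h⟩ z hzs)⟩
  have hrA : r ∈ A := ⟨hr, x, hxr, JoinedIn.refl ⟨r, hr, hxr⟩⟩
  obtain ⟨y, -, ⟨a, ha, hya⟩, ⟨b, hb, hyb⟩⟩ := isPreconnected_closed_iff.1 hconn.isPreconnected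
    (⋃₀ A) (⋃₀ B) (hclosed A fun _ h => h.1) (hclosed B fun _ h => h.1)
    (by
      rintro y ⟨u, hu, hyu⟩
      by_cases h : ∃ y ∈ u, JoinedIn (⋃₀ 𝒮) x y
      · exact Or.inl ⟨u, ⟨hu, h⟩, hyu⟩
      · exact Or.inr ⟨u, ⟨hu, h⟩, hyu⟩)
    ⟨x, ⟨r, hr, hxr⟩, ⟨r, hrA, hxr⟩⟩ ⟨z, ⟨s, hs, hzs⟩, ⟨s, hsB, hzs⟩⟩
  exact hb.2 ⟨y, hyb, hA a ha y hya⟩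

theorem finRotate_eq_mk_succ {n k : ℕ} (hk : k + 1 < n) :
    finRotate n ⟨k, by omega⟩ = ⟨k + 1, hk⟩ := by
  obtain ⟨m, rfl⟩ : ∃ m, n = m + 1 := ⟨n - 1, by omega⟩
  exact finRotate_of_lt (by omega)

namespace SimplePolygon

variable (P : SimplePolygon)

theorem boundary_eq : P.boundary =
    ⋃ i, segment ℝ (P.toPolygon.vertices i) (P.toPolygon.vertices (finRotate P.n i)) := by
  simp only [boundary, Polygon.boundary, Polygon.edgeSet, affineSegment_eq_segment]

theorem isClosed_boundary : IsClosed P.boundary := by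
  rw [boundary_eq]
  refine isClosed_iUnion_of_finite fun i => ?_
  rw [← convexHull_pair]
  exact (Set.toFinite _).isClosed_convexHull (𝕜 := ℝ)

theorem vertex_mem_boundary (i : Fin P.n) : P.toPolygon.vertices i ∈ P.boundary := by
  rw [boundary_eq]
  exact Set.mem_iUnion.2 ⟨i, left_mem_segment ℝ _ _⟩

theorem boundary_subset_region : P.boundary ⊆ P.region := Set.subset_union_left

theorem vertexSet_subset_region : P.vertexSet ⊆ P.region := by
  rintro _ ⟨i, rfl⟩
  exact P.boundary_subset_region (P.vertex_mem_boundary i)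

theorem boundary_subset_convexHull : P.boundary ⊆ convexHull ℝ P.vertexSet := by
  rw [boundary_eq]
  refine Set.iUnion_subset fun i => segment_subset_convexHull ⟨i, rfl⟩ ⟨_, rfl⟩

theorem vertices_injective : Function.Injective P.toPolygon.vertices := by
  intro i j h
  have := P.simple (x₁ := (i, 0)) (x₂ := (j, 0)) (by simp) (by simp)
    (by simpa [Polygon.edgePath] using h)
  exact congrArg Prod.fst this

theorem isPathConnected_boundary : IsPathConnected P.boundary := by
  have hn := P.three_le
  have hpos : 0 < P.n := by omega
  have edge : ∀ i, ∀ y ∈ segment ℝ (P.toPolygon.vertices i)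
      (P.toPolygon.vertices (finRotate P.n i)),
      JoinedIn P.boundary (P.toPolygon.vertices i) y := by
    intro i y hy
    refine ((convex_segment _ _).isPathConnected ⟨_, left_mem_segment ℝ _ _⟩ |>.joinedIn _
      (left_mem_segment ℝ _ _) y hy).mono ?_
    rw [boundary_eq]
    exact Set.subset_iUnion (fun i => segment ℝ (P.toPolygon.vertices i)
      (P.toPolygon.vertices (finRotate P.n i))) i
  have vert : ∀ k (hk : k < P.n), JoinedIn P.boundary (P.toPolygon.vertices ⟨0, hpos⟩)
      (P.toPolygon.vertices ⟨k, hk⟩) := by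
    intro k
    induction k with
    | zero => exact fun _ => JoinedIn.refl (P.vertex_mem_boundary _)
    | succ k ih =>
      intro hk
      refine (ih (by omega)).trans ?_
      rw [← finRotate_eq_mk_succ hk]
      exact edge _ _ (right_mem_segment ℝ _ _)
  refine ⟨_, P.vertex_mem_boundary ⟨0, hpos⟩, ?_⟩
  intro y hy
  rw [boundary_eq] at hy
  obtain ⟨i, hi⟩ := Set.mem_iUnion.1 hy
  exact (vert i i.2).trans (edge i y hi)

/-- A point outside lies in an unbounded component of the complement of the boundary, which is open
and misses the region. -/
theorem isClosed_region : IsClosed P.region := by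
  rw [← isOpen_compl_iff, isOpen_iff_mem_nhds]
  intro x hx
  have hxb : x ∈ P.boundaryᶜ := fun h => hx (Or.inl h)
  have hopen : IsOpen (connectedComponentIn P.boundaryᶜ x) :=
    P.isClosed_boundary.isOpen_compl.connectedComponentIn
  filter_upwards [hopen.mem_nhds (mem_connectedComponentIn hxb)] with y hy hyr
  rcases hyr with h | ⟨-, h⟩
  · exact connectedComponentIn_subset _ _ hy h
  · rw [← connectedComponentIn_eq hy] at h
    exact hx (Or.inr ⟨hxb, h⟩)

/-- Every ray from a point of the region meets the boundary, and stays in the region until it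
does. -/
theorem exists_ray_meets_boundary {x : Plane} (hx : x ∈ P.region) {u : Plane} (hu : u ≠ 0) :
    ∃ r : ℝ, 0 ≤ r ∧ x + r • u ∈ P.boundary ∧ segment ℝ x (x + r • u) ⊆ P.region := by
  by_cases hxb : x ∈ P.boundary
  · refine ⟨0, le_rfl, by simpa using hxb, ?_⟩
    simpa using hx
  have hbdd : Bornology.IsBounded (connectedComponentIn P.boundaryᶜ x) :=
    (hx.resolve_left hxb).2
  have hcont : Continuous fun s : ℝ => x + s • u := by fun_prop
  have stay : ∀ T : Set ℝ, IsPreconnected T → (0 : ℝ) ∈ T → (∀ s ∈ T, x + s • u ∉ P.boundary) →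
      (fun s : ℝ => x + s • u) '' T ⊆ connectedComponentIn P.boundaryᶜ x := by
    intro T hT h0 hav
    refine (hT.image _ hcont.continuousOn).subset_connectedComponentIn ⟨0, h0, by simp⟩ ?_
    rintro _ ⟨s, hs, rfl⟩
    exact hav s hs
  let H : Set ℝ := {s | 0 ≤ s ∧ x + s • u ∈ P.boundary}
  have hHne : H.Nonempty := by
    by_contra hemp
    rw [Set.not_nonempty_iff_eq_empty] at hemp
    have hsub := stay (Set.Ici 0) isPreconnected_Ici Set.self_mem_Ici
      (fun s hs hb => by have : s ∈ H := ⟨hs, hb⟩; rw [hemp] at this; exact this)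
    obtain ⟨R, hR⟩ := (hbdd.subset hsub).exists_norm_le
    have hupos := norm_pos_iff.2 hu
    have hR0 : 0 ≤ R := (norm_nonneg _).trans (hR x ⟨0, Set.self_mem_Ici, by simp⟩)
    -- The parameter makes the displacement from `x` long enough to leave the ball of radius `R`.
    have h1 := hR (x + ((R + ‖x‖ + 1) / ‖u‖) • u) ⟨_, by simp only [Set.mem_Ici]; positivity, rfl⟩
    have h2 : ‖((R + ‖x‖ + 1) / ‖u‖) • u‖ = R + ‖x‖ + 1 := by
      rw [norm_smul, Real.norm_of_nonneg (by positivity), div_mul_cancel₀ _ hupos.ne']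
    have h3 := norm_sub_le (x + ((R + ‖x‖ + 1) / ‖u‖) • u) x
    rw [add_sub_cancel_left, h2] at h3
    linarith
  have hHcl : IsClosed H :=
    isClosed_Ici.inter (P.isClosed_boundary.preimage hcont)
  have hHbdd : BddBelow H := ⟨0, fun s hs => hs.1⟩
  have hr := hHcl.csInf_mem hHne hHbdd
  -- The first hitting time: before it the ray stays in the bounded component of `x`.
  refine ⟨sInf H, hr.1, hr.2, ?_⟩
  rw [segment_eq_image']
  rintro _ ⟨θ, ⟨hθ0, hθ1⟩, rfl⟩
  simp only [add_sub_cancel_left, smul_smul]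
  rcases (mul_le_of_le_one_left hr.1 hθ1).eq_or_lt with he | hlt
  · rw [he]; exact Or.inl hr.2
  have hav : ∀ s ∈ Set.Icc 0 (θ * sInf H), x + s • u ∉ P.boundary := fun s hs hb =>
    absurd (csInf_le hHbdd (show s ∈ H from ⟨hs.1, hb⟩)) (not_le.2 (hs.2.trans_lt hlt))
  have h0 : 0 ≤ θ * sInf H := mul_nonneg hθ0 hr.1
  have hmem := stay _ isPreconnected_Icc (Set.left_mem_Icc.2 h0) hav
    ⟨_, Set.right_mem_Icc.2 h0, rfl⟩
  refine Or.inr ⟨hav _ (Set.right_mem_Icc.2 h0), ?_⟩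
  rwa [← connectedComponentIn_eq hmem]

theorem isPathConnected_region : IsPathConnected P.region := by
  obtain ⟨b, hb, hjoin⟩ := P.isPathConnected_boundary
  refine ⟨b, P.boundary_subset_region hb, fun {x} hx => ?_⟩
  obtain ⟨u, hu⟩ := exists_ne (0 : Plane)
  obtain ⟨r, -, hrb, hseg⟩ := P.exists_ray_meets_boundary hx hu
  refine ((hjoin hrb).mono P.boundary_subset_region).trans ?_
  exact ((convex_segment _ _).isPathConnected ⟨_, left_mem_segment ℝ _ _⟩ |>.joinedIn _
      (right_mem_segment ℝ _ _) x (left_mem_segment ℝ _ _)).mono hseg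

/-- Two opposite rays from `x` both hit the boundary, so `x` lies on a segment between boundary
points. -/
theorem region_subset_convexHull : P.region ⊆ convexHull ℝ P.vertexSet := by
  intro x hx
  obtain ⟨u, hu⟩ := exists_ne (0 : Plane)
  obtain ⟨r, hr0, hrb, -⟩ := P.exists_ray_meets_boundary hx hu
  obtain ⟨s, hs0, hsb, -⟩ := P.exists_ray_meets_boundary hx (neg_ne_zero.2 hu)
  have hr := P.boundary_subset_convexHull hrb
  have hs := P.boundary_subset_convexHull hsb
  rcases (add_nonneg hr0 hs0).eq_or_lt with h | h
  · obtain rfl : r = 0 := by linarith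
    simpa using hr
  · refine (convex_convexHull ℝ P.vertexSet).segment_subset hr hs ?_
    refine ⟨s / (r + s), r / (r + s), by positivity, by positivity, by field_simp; ring, ?_⟩
    ext i
    simp only [PiLp.add_apply, PiLp.smul_apply, PiLp.neg_apply, smul_eq_mul]
    field_simp
    ring

theorem finite_vertexSet : P.vertexSet.Finite := Set.finite_range _

end SimplePolygon

/-! ### Hulls and bridged unions -/

/-- The set of all vertices of a set of polygons. -/
def vertexUnion (Q : Set SimplePolygon) : Set Plane := ⋃ P ∈ Q, P.vertexSet

theorem vertexUnion_subset_polyUnion (Q : Set SimplePolygon) : vertexUnion Q ⊆ polyUnion Q :=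
  Set.iUnion₂_mono fun P _ => P.vertexSet_subset_region

theorem hull_eq_convexHull_vertexUnion (Q : Set SimplePolygon) :
    hull Q = convexHull ℝ (vertexUnion Q) := by
  refine Set.Subset.antisymm (convexHull_min ?_ (convex_convexHull ℝ _))
    (convexHull_mono (vertexUnion_subset_polyUnion Q))
  exact Set.iUnion₂_subset fun P hP => P.region_subset_convexHull.trans
    (convexHull_mono (Set.subset_biUnion_of_mem (u := fun P : SimplePolygon => P.vertexSet) hP))

theorem polyUnion_union_segUnion_eq_sUnion (Q : Set SimplePolygon) (S : Set PlaneSegment) :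
    polyUnion Q ∪ segUnion S =
      ⋃₀ (SimplePolygon.region '' Q ∪ PlaneSegment.carrier '' S) := by
  rw [Set.sUnion_union, Set.sUnion_image, Set.sUnion_image, polyUnion, segUnion]

/-- Three vertices of a single polygon are not collinear, so they already span the plane affinely.
-/
theorem interior_hull_nonempty {I Q : Set SimplePolygon} (hI : IsPolygonInput I) (hQ : Q ⊆ I)
    (hne : Q.Nonempty) : (interior (convexHull ℝ (vertexUnion Q))).Nonempty := by
  obtain ⟨P, hP⟩ := hne
  have hn := P.three_le
  have hmem : ∀ i, P.toPolygon.vertices i ∈ vertexUnion Q := fun i =>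
    Set.mem_biUnion hP ⟨i, rfl⟩
  have hmemI : ∀ i, P.toPolygon.vertices i ∈ ⋃ P ∈ I, P.vertexSet := fun i =>
    Set.mem_biUnion (hQ hP) ⟨i, rfl⟩
  let i : Fin 3 → Fin P.n := Fin.castLE hn
  have hinj : Function.Injective (P.toPolygon.vertices ∘ i) :=
    P.vertices_injective.comp (Fin.castLE_injective hn)
  have hcol := hI.generalPosition _ (hmemI (i 0)) _ (hmemI (i 1)) _ (hmemI (i 2))
    (hinj.ne (show (0 : Fin 3) ≠ 1 by decide)) (hinj.ne (show (1 : Fin 3) ≠ 2 by decide))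
    (hinj.ne (show (0 : Fin 3) ≠ 2 by decide))
  rw [← affineIndependent_iff_not_collinear_set] at hcol
  rw [interior_convexHull_nonempty_iff_affineSpan_eq_top, eq_top_iff,
    ← hcol.affineSpan_eq_top_iff_card_eq_finrank_add_one.2 (by simp)]
  refine affineSpan_mono ℝ ?_
  rintro _ ⟨k, rfl⟩
  fin_cases k
  · exact hmem _
  · exact hmem _
  · exact hmem _

namespace BridgeableBy

variable {I Q : Set SimplePolygon} {S : Set PlaneSegment}

theorem nonempty (h : BridgeableBy I Q S) : Q.Nonempty := by
  obtain ⟨x, hx | hx⟩ := h.connected.nonempty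
  · obtain ⟨P, hP, -⟩ := Set.mem_iUnion₂.1 hx
    exact ⟨P, hP⟩
  · obtain ⟨s, hs, -⟩ := Set.mem_iUnion₂.1 hx
    obtain ⟨P, hP, -⟩ := h.endpoint s hs
    exact ⟨P, hP⟩

theorem isPathConnected (h : BridgeableBy I Q S) (hI : IsPolygonInput I) :
    IsPathConnected (polyUnion Q ∪ segUnion S) := by
  have hc := h.connected
  rw [polyUnion_union_segUnion_eq_sUnion] at hc ⊢
  refine isPathConnected_sUnion_of_isConnected
    (((hI.finite.subset h.subset).image _).union (h.finite.image _)) ?_ ?_ hc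
  · rintro _ (⟨P, -, rfl⟩ | ⟨s, -, rfl⟩)
    · exact P.isClosed_region
    · rw [PlaneSegment.carrier, ← convexHull_pair]
      exact (Set.toFinite _).isClosed_convexHull (𝕜 := ℝ)
  · rintro _ (⟨P, -, rfl⟩ | ⟨s, -, rfl⟩)
    · exact P.isPathConnected_region
    · exact (convex_segment _ _).isPathConnected ⟨_, left_mem_segment ℝ _ _⟩

theorem subset_convexHull (h : BridgeableBy I Q S) :
    polyUnion Q ∪ segUnion S ⊆ convexHull ℝ (vertexUnion Q) := by
  rw [← hull_eq_convexHull_vertexUnion]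
  exact Set.union_subset (_root_.subset_convexHull ℝ _) (Set.iUnion₂_subset h.subset_hull)

end BridgeableBy

/-- Polygons are disjoint by assumption on `I`, segments by compatibility; a segment of one family
meeting a polygon of the other would place that polygon in both families. -/
theorem disjoint_bridged_unions {I P₁ P₂ : Set SimplePolygon} {S₁ S₂ : Set PlaneSegment}
    (hI : IsPolygonInput I) (hP : Disjoint P₁ P₂) (h₁ : BridgeableBy I P₁ S₁)
    (h₂ : BridgeableBy I P₂ S₂) (hS : ∀ s₁ ∈ S₁, ∀ s₂ ∈ S₂, Disjoint s₁.carrier s₂.carrier) :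
    Disjoint (polyUnion P₁ ∪ segUnion S₁) (polyUnion P₂ ∪ segUnion S₂) := by
  rw [Set.disjoint_left]
  rintro x (hx | hx) (hy | hy) <;> obtain ⟨A, hA, hxA⟩ := Set.mem_iUnion₂.1 hx <;>
    obtain ⟨B, hB, hxB⟩ := Set.mem_iUnion₂.1 hy
  · exact (hI.disjoint (h₁.subset hA) (h₂.subset hB) (hP.ne_of_mem hA hB)).le_bot ⟨hxA, hxB⟩
  · exact hP.le_bot ⟨hA, h₂.mem_of_meets B hB A (h₁.subset hA) ⟨x, hxB, hxA⟩⟩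
  · exact hP.le_bot ⟨h₁.mem_of_meets A hA B (h₂.subset hB) ⟨x, hxA, hxB⟩, hB⟩
  · exact (hS A hA B hB).le_bot ⟨hxA, hxB⟩

theorem finite_vertexUnion {Q : Set SimplePolygon} (h : Q.Finite) : (vertexUnion Q).Finite :=
  h.biUnion fun P _ => P.finite_vertexSet

theorem mainTheorem5 (I : Set SimplePolygon) (hI : IsPolygonInput I)
    (P₁ P₂ : Set SimplePolygon) (h : Compatible I P₁ P₂) :
    (frontier (hull P₁) ∩ frontier (hull P₂)).encard ≤ 2 := by
  obtain ⟨hP, ⟨S₁, S₂, h₁, h₂, hS⟩, -⟩ := h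
  have hX := h₁.isPathConnected hI
  have hY := h₂.isPathConnected hI
  have hdisj := disjoint_bridged_unions hI hP h₁ h₂ hS
  have hV : vertexUnion P₁ ⊆ polyUnion P₁ ∪ segUnion S₁ :=
    (vertexUnion_subset_polyUnion P₁).trans Set.subset_union_left
  have hW : vertexUnion P₂ ⊆ polyUnion P₂ ∪ segUnion S₂ :=
    (vertexUnion_subset_polyUnion P₂).trans Set.subset_union_left
  have hsub : vertexUnion P₁ ∪ vertexUnion P₂ ⊆ ⋃ P ∈ I, P.vertexSet :=
    Set.union_subset (Set.biUnion_mono h₁.subset fun _ _ => le_rfl)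
      (Set.biUnion_mono h₂.subset fun _ _ => le_rfl)
  rw [hull_eq_convexHull_vertexUnion, hull_eq_convexHull_vertexUnion]
  set C₁ := convexHull ℝ (vertexUnion P₁)
  set C₂ := convexHull ℝ (vertexUnion P₂)
  -- The two sets on the right are the two kinds of crossing; each has at most one element.
  have hcover : frontier C₁ ∩ frontier C₂ ⊆
      {p | ∃ v ∈ vertexUnion P₁, ∃ t ∈ vertexUnion P₂, IsCrossing C₁ C₂ p v t} ∪
      {p | ∃ v ∈ vertexUnion P₂, ∃ t ∈ vertexUnion P₁, IsCrossing C₂ C₁ p v t} := by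
    rintro p ⟨hp₁, hp₂⟩
    exact exists_isCrossing_of_mem_frontier
      (finite_vertexUnion (hI.finite.subset h₁.subset))
      (finite_vertexUnion (hI.finite.subset h₂.subset)) (hdisj.mono hV hW)
      (fun x hx y hy z hz hxy hyz hxz h0 =>
        hI.generalPosition x (hsub hx) y (hsub hy) z (hsub hz) hxy hyz hxz
          (collinear_of_orient_eq_zero h0))
      (interior_hull_nonempty hI h₁.subset h₁.nonempty)
      (interior_hull_nonempty hI h₂.subset h₂.nonempty) hp₁ hp₂
  refine (Set.encard_le_encard hcover).trans ((Set.encard_union_le _ _).trans ?_)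
  rw [← one_add_one_eq_two]
  refine add_le_add (Set.encard_le_one_iff.2 ?_) (Set.encard_le_one_iff.2 ?_)
  · rintro p q ⟨v, hv, t, ht, hp⟩ ⟨v', hv', t', ht', hq⟩
    exact hp.eq_of_disjoint hX hY h₁.subset_convexHull h₂.subset_convexHull hdisj hq
      (hV hv) (hV hv') (hW ht) (hW ht')
  · rintro p q ⟨v, hv, t, ht, hp⟩ ⟨v', hv', t', ht', hq⟩
    exact hp.eq_of_disjoint hY hX h₂.subset_convexHull h₁.subset_convexHull hdisj.symm hq
      (hW hv) (hW hv') (hV ht) (hV ht')
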